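/- Let $\Bbbk$ be an algebraically closed field of characteristic $0$, $\Gamma$ a noetherian commutative $\Bbbk$-algebra which is a domain, $K$ its field of fractions, $L/K$ a finite Galois extension with group $G$, and $\bar\Gamma$ the integral closure of $\Gamma$ in $L$. Let $\mathcal M$ be a submonoid of the group $\operatorname{Aut}_{\Bbbk} L$ that is closed under conjugation by $G$ and separating with respect to $K$, i.e. if $m_1,m_2\in\mathcal M$ and $m_1|_K=m_2|_K$ then $m_1=m_2$. Let $L*\mathcal M$ be the skew monoid ring, with multiplication $(am)(bm')=(a\,m(b))(mm')$ for $a,b\in L$, $m,m'\in\mathcal M$, on which $g\in G$ acts by $am\mapsto g(a)\,(gmg^{-1})$, and let $\mathcal K=(L*\mathcal M)^G$ be the ring of invariants. A Galois ring over $\Gamma$ is a subring $U\subset\mathcal K$ generated by $\Gamma$ and finitely many elements, with $KU=UK=\mathcal K$. It is a Galois order if for every finite dimensional right (respectively left) $K$-subspace $W\subset\mathcal K$ the right (respectively left) $\Gamma$-module $W\cap U$ is finitely generated. For maximal ideals $\mathfrak m,\mathfrak n$ of $\Gamma$ put $$\mathcal A(\mathfrak m,\mathfrak n)=\varinjlim_{V}\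 \varprojlim_{a,b}\ V/(\mathfrak n^{a}V+V\mathfrak m^{b}),$$ where $V$ runs over the finitely generated $\Gamma$-subbimodules of $U$; the image of $u\in U$ in $\mathcal A(\mathfrak m,\mathfrak n)$ is the class of $u\in\Gamma u\Gamma$. Choose maximal ideals $\ell_{\mathfrak m},\ell_{\mathfrak n}$ of $\bar\Gamma$ lying over $\mathfrak m$ and $\mathfrak n$, let $\mathcal M_{\mathfrak m}=\{\sigma\in\mathcal M:\sigma(\ell_{\mathfrak m})=\ell_{\mathfrak m}\}$ and $\mathcal M_{\mathfrak n}=\{\sigma\in\mathcal M:\sigma(\ell_{\mathfrak n})=\ell_{\mathfrak n}\}$, and let $$S=S(\mathfrak m,\mathfrak n)=\{\sigma\in\mathcal M:\ g_2(\ell_{\mathfrak n})=\sigma g_1(\ell_{\mathfrak m})\text{ for some }g_1,g_2\in G\},\qquad U(S)=\{u\in U:\operatorname{supp}u\subset S\},$$ where $\operatorname{supp}u\subset\mathcal M$ is the set of those $m$ whose coefficient in $u$ is nonzero, and the translates of $\ell_{\mathfrak m}$ and $\ell_{\mathfrak n}$ are compared as subsets of $L$. **Theorem.** Let $U$ be a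 Galois order over $\Gamma$, and let $\mathfrak m,\mathfrak n$ be maximal ideals of $\Gamma$ such that $S(\mathfrak m,\mathfrak n)$ is finite and nonempty and $\mathcal M_{\mathfrak m}$, $\mathcal M_{\mathfrak n}$ are finite. Then the image of $U(S)$ in $\mathcal A(\mathfrak m,\mathfrak n)$ is nonzero. -/

import Mathlib

noncomputable section

namespace GaloisOrder

/-! ### Finitely generated modules inside a ring, over a possibly noncentral subalgebra -/

section Generated

variable {k A : Type*} [Field k] [Ring A] [Algebra k A]

/-- `W` is a finitely generated left `R`-submodule of `A`. -/
def IsFGLeft (R : Subalgebra k A) (W : Submodule k A) : Prop :=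
  ∃ T : Finset A, W = Subalgebra.toSubmodule R * Submodule.span k (T : Set A)

/-- `W` is a finitely generated right `R`-submodule of `A`. -/
def IsFGRight (R : Subalgebra k A) (W : Submodule k A) : Prop :=
  ∃ T : Finset A, W = Submodule.span k (T : Set A) * Subalgebra.toSubmodule R

/-- The `R`-subbimodule `R T R` of `A` generated by a set `T`. -/
def bimoduleSpan (R : Subalgebra k A) (T : Set A) : Submodule k A :=
  Subalgebra.toSubmodule R * Submodule.span k T * Subalgebra.toSubmodule R

/-- `W` is a finitely generated `R`-subbimodule of `A`. -/
def IsFGBimodule (R : Subalgebra k A) (W : Submodule k A) : Prop :=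
  ∃ T : Finset A, W = bimoduleSpan R (T : Set A)

theorem subset_bimoduleSpan (R : Subalgebra k A) (T : Set A) :
    T ⊆ (bimoduleSpan R T : Set A) := by
  intro t ht
  have h := Submodule.mul_mem_mul (Submodule.mul_mem_mul (show (1 : A) ∈ Subalgebra.toSubmodule R
    from R.one_mem) (Submodule.subset_span (R := k) ht))
    (show (1 : A) ∈ Subalgebra.toSubmodule R from R.one_mem)
  simpa [bimoduleSpan] using h

theorem bimoduleSpan_mono (R : Subalgebra k A) {T T' : Set A} (h : T ⊆ T') :
    bimoduleSpan R T ≤ bimoduleSpan R T' :=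
  mul_le_mul' (mul_le_mul' le_rfl (Submodule.span_mono h)) le_rfl

end Generated

/-! ### The category of a pair `Γ ⊆ U`

For a commutative algebra `Γ` and a ring `U` with a (not necessarily central) map `i : Γ → U`, the
objects of the category are the maximal ideals of `Γ`, and the morphisms from `m` to `n` are the
elements of `colim_V lim_{a,b} V / (n ^ a V + V m ^ b)`, where `V` runs over the finitely generated
`Γ`-subbimodules of `U`. -/

section Category

variable {k Γ U : Type*} [Field k] [CommRing Γ] [Algebra k Γ] [Ring U] [Algebra k U]
variable (i : Γ →ₐ[k] U)

/-- The image in `U` of an ideal of `Γ`. -/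
def idealImage (I : Ideal Γ) : Submodule k U :=
  (I.restrictScalars k).map i.toLinearMap

theorem idealImage_mono {I J : Ideal Γ} (h : I ≤ J) : idealImage i I ≤ idealImage i J :=
  Submodule.map_mono (fun _ hx => h hx)

/-- The set of finitely generated `Γ`-subbimodules of `U`, ordered by inclusion. -/
abbrev FGBimodule : Type _ := {V : Submodule k U // IsFGBimodule i.range V}

/-- `n ^ a V + V m ^ b`, as a subspace of `V`. -/
def level (m n : Ideal Γ) (V : Submodule k U) (p : ℕ × ℕ) : Submodule k V :=
  (idealImage i (n ^ p.1) * V ⊔ V * idealImage i (m ^ p.2)).submoduleOf V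

theorem level_anti (m n : Ideal Γ) (V : Submodule k U) {p q : ℕ × ℕ} (h : p ≤ q) :
    level i m n V q ≤ level i m n V p :=
  Submodule.comap_mono (sup_le_sup
    (mul_le_mul' (idealImage_mono i (Ideal.pow_le_pow_right h.1)) le_rfl)
    (mul_le_mul' le_rfl (idealImage_mono i (Ideal.pow_le_pow_right h.2))))

theorem level_le_comap (m n : Ideal Γ) {V W : Submodule k U} (h : V ≤ W) (p : ℕ × ℕ) :
    level i m n V p ≤ (level i m n W p).comap (Submodule.inclusion h) := fun _ hx =>
  (sup_le_sup (mul_le_mul' le_rfl h) (mul_le_mul' h le_rfl) :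
    idealImage i (n ^ p.1) * V ⊔ V * idealImage i (m ^ p.2) ≤
      idealImage i (n ^ p.1) * W ⊔ W * idealImage i (m ^ p.2)) hx

/-- The completion `lim_{a,b} V / (n ^ a V + V m ^ b)`: compatible families of classes. -/
def completion (m n : Ideal Γ) (V : Submodule k U) :
    Submodule k (∀ p : ℕ × ℕ, V ⧸ level i m n V p) where
  carrier := {x | ∀ (p q : ℕ × ℕ) (h : p ≤ q), Submodule.factor (level_anti i m n V h) (x q) = x p}
  add_mem' hx hy p q h := by simp [hx p q h, hy p q h]
  zero_mem' p q h := by simp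
  smul_mem' c x hx p q h := by simp [hx p q h]

/-- The canonical map from `V` to its completion. -/
def toCompletion (m n : Ideal Γ) (V : Submodule k U) : V →ₗ[k] completion i m n V :=
  (LinearMap.pi fun p => (level i m n V p).mkQ).codRestrict (completion i m n V)
    (fun _ _ _ _ => rfl)

/-- The map of completions induced by an inclusion `V ≤ W`. -/
def completionMap (m n : Ideal Γ) {V W : Submodule k U} (h : V ≤ W) :
    completion i m n V →ₗ[k] completion i m n W :=
  ((LinearMap.pi fun p => (Submodule.mapQ (level i m n V p) (level i m n W p)
      (Submodule.inclusion h) (level_le_comap i m n h p)).comp (LinearMap.proj p)).comp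
    (completion i m n V).subtype).codRestrict (completion i m n W) (by
      rintro ⟨x, hx⟩ p q hpq
      have hxp := hx p q hpq
      obtain ⟨v, hv⟩ := Submodule.mkQ_surjective _ (x q)
      simp only [LinearMap.comp_apply, LinearMap.pi_apply, LinearMap.proj_apply,
        Submodule.subtype_apply]
      rw [← hxp, ← hv]
      rfl)

theorem completionMap_toCompletion (m n : Ideal Γ) {V W : Submodule k U} (h : V ≤ W) (v : V) :
    completionMap i m n h (toCompletion i m n V v) =
      toCompletion i m n W (Submodule.inclusion h v) := rfl

open Classical in
/-- The space of morphisms from `m` to `n`. -/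
abbrev Hom (m n : Ideal Γ) : Type _ :=
  Module.DirectLimit (R := k) (ι := FGBimodule i) (fun V => completion i m n V.1)
    (fun _ _ h => completionMap i m n h)

/-- The finitely generated subbimodule `Γ u Γ`. -/
def principal (u : U) : FGBimodule i := ⟨bimoduleSpan i.range {u}, {u}, by simp⟩

theorem mem_principal (u : U) : u ∈ (principal i u).1 := subset_bimoduleSpan _ _ rfl

instance : IsDirectedOrder (FGBimodule i) where
  directed := by
    classical
    rintro ⟨_, T, rfl⟩ ⟨_, T', rfl⟩
    exact ⟨⟨_, T ∪ T', rfl⟩, bimoduleSpan_mono _ (by simp), bimoduleSpan_mono _ (by simp)⟩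

open Classical in
/-- The class in `Hom m n` of an element `u` of a finitely generated subbimodule `V`. -/
def classOf (m n : Ideal Γ) (V : FGBimodule i) : V.1 →ₗ[k] Hom i m n :=
  (Module.DirectLimit.of k (FGBimodule i) (fun V => completion i m n V.1)
    (fun _ _ h => completionMap i m n h) V).comp (toCompletion i m n V.1)

theorem classOf_inclusion (m n : Ideal Γ) {V W : FGBimodule i} (h : V ≤ W) (v : V.1) :
    classOf i m n W (Submodule.inclusion h v) = classOf i m n V v := by
  classical
  exact Module.DirectLimit.of_f (f := fun (V W : FGBimodule i) (h : V ≤ W) =>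
    completionMap i m n h) (hij := h) (x := toCompletion i m n V.1 v)

theorem classOf_eq (m n : Ideal Γ) (V W : FGBimodule i) {u : U} (hV : u ∈ V.1) (hW : u ∈ W.1) :
    classOf i m n V ⟨u, hV⟩ = classOf i m n W ⟨u, hW⟩ := by
  obtain ⟨X, hX, hX'⟩ := exists_ge_ge V W
  rw [← classOf_inclusion i m n hX, ← classOf_inclusion i m n hX']
  rfl

/-- The canonical map `U → Hom m n`, sending `u` to the class of `u ∈ Γ u Γ`. -/
def toHom (m n : Ideal Γ) : U →ₗ[k] Hom i m n where
  toFun u := classOf i m n (principal i u) ⟨u, mem_principal i u⟩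
  map_add' u v := by
    obtain ⟨X, hX, hX'⟩ := exists_ge_ge (principal i u) (principal i v)
    have hu : u ∈ X.1 := hX (mem_principal i u)
    have hv : v ∈ X.1 := hX' (mem_principal i v)
    rw [classOf_eq i m n _ X _ (X.1.add_mem hu hv), classOf_eq i m n _ X _ hu,
      classOf_eq i m n _ X _ hv, ← map_add]
    rfl
  map_smul' c u := by
    have hu := mem_principal i u
    rw [classOf_eq i m n _ (principal i u) _ (Submodule.smul_mem _ c hu), RingHom.id_apply,
      ← map_smul]
    rfl

end Category

/-! ### Skew monoid rings and their invariants -/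

section Skew

variable {k K L : Type*} [Field k] [Field K] [Field L] [Algebra k K] [Algebra K L] [Algebra k L]
  [IsScalarTower k K L]

/-- An element of the Galois group of `L / K`, as an automorphism of the `k`-algebra `L`. -/
def galAut (k : Type*) {K L : Type*} [Field k] [Field K] [Field L] [Algebra k K] [Algebra K L]
    [Algebra k L] [IsScalarTower k K L] : (L ≃ₐ[K] L) →* (L ≃ₐ[k] L) where
  toFun g := g.restrictScalars k
  map_one' := rfl
  map_mul' _ _ := rfl

/-- `M` is closed under conjugation by the Galois group of `L / K`. -/
def IsConjStable (K : Type*) [Field K] [Algebra k K] [Algebra K L] [IsScalarTower k K L]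
    (M : Submonoid (L ≃ₐ[k] L)) : Prop :=
  ∀ (g : L ≃ₐ[K] L), ∀ m ∈ M, galAut k g * m * (galAut k g)⁻¹ ∈ M

/-- `M` is separating with respect to `K`: its elements are determined by their restrictions
to `K`. -/
def IsSeparating (K : Type*) [Field K] [Algebra K L] (M : Submonoid (L ≃ₐ[k] L)) : Prop :=
  ∀ m₁ ∈ M, ∀ m₂ ∈ M, (∀ x : K, m₁ (algebraMap K L x) = m₂ (algebraMap K L x)) → m₁ = m₂

/-- The skew monoid ring `L * M`, with `(a m) (b m') = (a m(b)) (m m')`. -/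
abbrev Skew (M : Submonoid (L ≃ₐ[k] L)) : Type _ := SkewMonoidAlgebra L M

/-- The embedding `a ↦ a • 1` of `L` into `L * M`. -/
def coeffHom (M : Submonoid (L ≃ₐ[k] L)) : L →ₐ[k] Skew M where
  toFun a := SkewMonoidAlgebra.single 1 a
  map_one' := rfl
  map_zero' := SkewMonoidAlgebra.single_zero 1
  map_add' := SkewMonoidAlgebra.single_add 1
  map_mul' a b := by simp [SkewMonoidAlgebra.single_mul_single]
  commutes' _ := rfl

theorem coeffHom_apply (M : Submonoid (L ≃ₐ[k] L)) (a : L) :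
    coeffHom M a = SkewMonoidAlgebra.single 1 a := rfl

variable {M : Submonoid (L ≃ₐ[k] L)}

/-- Conjugation `m ↦ g m g⁻¹` on `M`. -/
def conjHom (hM : IsConjStable K M) (g : L ≃ₐ[K] L) : M →* M where
  toFun m := ⟨galAut k g * m * (galAut k g)⁻¹, hM g m m.2⟩
  map_one' := by ext; simp
  map_mul' m m' := by ext; simp

/-- The action of `g` in the Galois group on `L * M`: `a m ↦ g(a) (g m g⁻¹)`. -/
def galAct (hM : IsConjStable K M) (g : L ≃ₐ[K] L) : Skew M →ₐ[k] Skew M :=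
  SkewMonoidAlgebra.liftNCAlgHom ((coeffHom M).comp (galAut k g : L →ₐ[k] L))
    ((SkewMonoidAlgebra.of L M).comp (conjHom hM g)) (by
      intro a m
      simp [coeffHom_apply, SkewMonoidAlgebra.single_mul_single, conjHom, Submonoid.smul_def])

theorem galAct_single (hM : IsConjStable K M) (g : L ≃ₐ[K] L) (m : M) (a : L) :
    galAct hM g (SkewMonoidAlgebra.single m a) =
      SkewMonoidAlgebra.single (conjHom hM g m) (g a) := by
  have h : galAct hM g (SkewMonoidAlgebra.single m a) =
      coeffHom M (g a) * SkewMonoidAlgebra.of L M (conjHom hM g m) :=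
    SkewMonoidAlgebra.liftNC_single _ _ _ _
  rw [h]
  simp [coeffHom_apply, SkewMonoidAlgebra.single_mul_single]

/-- The subring `(L * M) ^ G` of invariants of the Galois group. -/
def invariants (hM : IsConjStable K M) : Subalgebra k (Skew M) :=
  ⨅ g : L ≃ₐ[K] L, AlgHom.equalizer (galAct hM g) (AlgHom.id k (Skew M))

/-- The embedding into `L * M` of an algebra `R` that maps to `L`. -/
def baseHom (R : Type*) [CommRing R] [Algebra k R] [Algebra R L] [IsScalarTower k R L]
    (M : Submonoid (L ≃ₐ[k] L)) : R →ₐ[k] Skew M :=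
  (coeffHom M).comp (IsScalarTower.toAlgHom k R L)

variable {Γ : Type*} [CommRing Γ] [Algebra k Γ] [Algebra Γ L] [IsScalarTower k Γ L]

/-- `U` is a Galois ring over `Γ`: a subring of `(L * M) ^ G` that is generated over `Γ` by finitely
many elements and satisfies `K U = U K = (L * M) ^ G`. -/
structure IsGaloisRing (Γ : Type*) [CommRing Γ] [Algebra k Γ] [Algebra Γ L] [IsScalarTower k Γ L]
    (hM : IsConjStable K M) (U : Subalgebra k (Skew M)) : Prop where
  le_invariants : U ≤ invariants hM
  finitelyGenerated : ∃ T : Finset (Skew M), U = (baseHom Γ M).range ⊔ Algebra.adjoin k (T : Set _)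
  left_span : Subalgebra.toSubmodule (baseHom K M).range * Subalgebra.toSubmodule U =
    Subalgebra.toSubmodule (invariants hM)
  right_span : Subalgebra.toSubmodule U * Subalgebra.toSubmodule (baseHom K M).range =
    Subalgebra.toSubmodule (invariants hM)

/-- `U` is a Galois order over `Γ`: a Galois ring such that `W ∩ U` is a finitely generated right
(left) `Γ`-module for each finite dimensional right (left) `K`-subspace `W` of `(L * M) ^ G`. -/
structure IsGaloisOrder (Γ : Type*) [CommRing Γ] [Algebra k Γ] [Algebra Γ L] [IsScalarTower k Γ L]
    (hM : IsConjStable K M) (U : Subalgebra k (Skew M)) : Prop extends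
    IsGaloisRing Γ hM U where
  right_order : ∀ W ≤ Subalgebra.toSubmodule (invariants hM), IsFGRight (baseHom K M).range W →
    IsFGRight (baseHom Γ M).range (W ⊓ Subalgebra.toSubmodule U)
  left_order : ∀ W ≤ Subalgebra.toSubmodule (invariants hM), IsFGLeft (baseHom K M).range W →
    IsFGLeft (baseHom Γ M).range (W ⊓ Subalgebra.toSubmodule U)

theorem IsGaloisRing.base_le {hM : IsConjStable K M} {U : Subalgebra k (Skew M)}
    (hU : IsGaloisRing Γ hM U) (γ : Γ) : baseHom Γ M γ ∈ U := by
  obtain ⟨T, hT⟩ := hU.finitelyGenerated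
  rw [hT]
  exact (le_sup_left : (baseHom Γ M).range ≤ _) ⟨γ, rfl⟩

/-- The embedding of `Γ` into a Galois ring `U` over `Γ`. -/
def IsGaloisRing.incl {hM : IsConjStable K M} {U : Subalgebra k (Skew M)}
    (hU : IsGaloisRing Γ hM U) : Γ →ₐ[k] U :=
  (baseHom Γ M).codRestrict U hU.base_le

/-- `U(S)`: the elements of `U` with support in `S`. -/
def supportedIn (U : Subalgebra k (Skew M)) (S : Set M) : Submodule k U where
  carrier := {u | ∀ m, (u : Skew M).coeff m ≠ 0 → m ∈ S}
  add_mem' {u v} hu hv m h := by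
    by_contra hm
    have h1 : (u : Skew M).coeff m = 0 := not_not.1 fun h' => hm (hu m h')
    have h2 : (v : Skew M).coeff m = 0 := not_not.1 fun h' => hm (hv m h')
    exact h (by simp [h1, h2])
  zero_mem' m h := absurd (by simp) h
  smul_mem' c u hu m h := hu m fun h' => h (by simp [h'])

end Skew

/-! ### Maximal ideals of the integral closure -/

section Ideals

variable {k K Γ L : Type*} [Field k] [Field K] [Field L] [Algebra k K] [Algebra K L] [Algebra k L]
  [IsScalarTower k K L] [CommRing Γ] [Algebra Γ L]

/-- `l` is a maximal ideal of the integral closure of `Γ` in `L` lying over `m`. -/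
def LiesAbove (l : Ideal (integralClosure Γ L)) (m : Ideal Γ) : Prop :=
  l.IsMaximal ∧ l.comap (algebraMap Γ (integralClosure Γ L)) = m

/-- The image `σ(l)`, as a subset of `L`, of an ideal of the integral closure of `Γ` in `L`.
Working with subsets of `L` makes sense of `σ(l)` whether or not `σ` preserves the integral
closure. -/
def translate (σ : L ≃ₐ[k] L) (l : Ideal (integralClosure Γ L)) : Set L :=
  (fun x : integralClosure Γ L => σ (x : L)) '' (l : Set (integralClosure Γ L))

/-- The stabilizer of `l` in `M`. -/
def stabilizer (M : Submonoid (L ≃ₐ[k] L)) (l : Ideal (integralClosure Γ L)) : Set M :=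
  {σ | translate (σ : L ≃ₐ[k] L) l = translate (1 : L ≃ₐ[k] L) l}

/-- `S(m, n)`, in terms of ideals `lm` over `m` and `ln` over `n`: the elements `σ` of `M` with
`g₂ ln = σ g₁ lm` for some `g₁`, `g₂` in the Galois group of `L / K`. -/
def connecting (K : Type*) [Field K] [Algebra k K] [Algebra K L] [IsScalarTower k K L]
    (M : Submonoid (L ≃ₐ[k] L)) (lm ln : Ideal (integralClosure Γ L)) : Set M :=
  {σ | ∃ g₁ g₂ : L ≃ₐ[K] L,
    translate (galAut k g₂) ln = translate ((σ : L ≃ₐ[k] L) * galAut k g₁) lm}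

end Ideals

end GaloisOrder

end

/-! Two facts give the result. First, `U(S)` contains an element with nonzero coefficient at a given
`σ ∈ S`: the sum of the `G`-conjugates of `σ` is invariant, is supported in `S` because `S` is
stable under conjugation, and lands in `U` after clearing a denominator in `Γ`. Second, an element
`u ∈ U` with nonzero coefficient `u_σ` at some `σ ∈ S` survives in `A(m, n)`
(`IsGaloisOrder.notMem_ker_toHom`). Taking the coefficient at `σ` turns the left and right actions
of `Γ` on `U` into multiplication by `Γ` and `σ(Γ)` in `L`, hence by the domain `B = Γ[σ(Γ)]`. The
order condition makes `B` a finite `Γ`-module, so `B` is noetherian and integral over `Γ`. The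
relation `g₂(ln) = σ g₁(lm)` yields a proper ideal `q` of `B` containing `n` and `σ(m)`. If `u` died
in the limit, `u_σ` would lie in `q ^ a N` for all `a`, with `N ⊆ L` a finitely generated
`B`-module, and Krull's intersection theorem would give `u_σ = 0`. -/

namespace GaloisOrder

/-! ### Coefficients and invariants in the skew monoid ring. -/

section Coefficients

variable {k K L : Type*} [Field k] [Field K] [Field L] [Algebra k K] [Algebra K L] [Algebra k L]
  [IsScalarTower k K L] {M : Submonoid (L ≃ₐ[k] L)}
  {R : Type*} [CommRing R] [Algebra k R] [Algebra R L] [IsScalarTower k R L]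

theorem coeff_baseHom_mul (r : R) (x : Skew M) (σ : M) :
    (baseHom R M r * x).coeff σ = algebraMap R L r * x.coeff σ :=
  SkewMonoidAlgebra.coeff_single_one_mul _ _ _

theorem coeff_mul_baseHom (r : R) (x : Skew M) (σ : M) :
    (x * baseHom R M r).coeff σ = x.coeff σ * (σ : L ≃ₐ[k] L) (algebraMap R L r) :=
  SkewMonoidAlgebra.coeff_mul_single_one _ _ _

theorem baseHom_mul_eq_smul (r : R) (x : Skew M) : baseHom R M r * x = r • x := by
  ext σ
  rw [coeff_baseHom_mul, SkewMonoidAlgebra.coeff_smul, Finsupp.smul_apply, Algebra.smul_def]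

theorem baseHom_algebraMap {S : Type*} [CommRing S] [Algebra k S] [Algebra S L]
    [IsScalarTower k S L] [Algebra R S] [IsScalarTower R S L] (r : R) :
    baseHom S M (algebraMap R S r) = baseHom R M r :=
  congrArg (SkewMonoidAlgebra.single 1) (IsScalarTower.algebraMap_apply R S L r).symm

/-- The coefficient at `σ`, as a linear map. -/
noncomputable def coeffAt (R : Type*) [CommRing R] [Algebra R L] (σ : M) : Skew M →ₗ[R] L where
  toFun x := x.coeff σ
  map_add' x y := by rw [SkewMonoidAlgebra.coeff_add, Finsupp.add_apply]
  map_smul' r x := by rw [SkewMonoidAlgebra.coeff_smul, Finsupp.smul_apply, RingHom.id_apply]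

theorem coeffAt_apply {S : Type*} [CommRing S] [Algebra S L] (σ : M) (x : Skew M) :
    coeffAt S σ x = x.coeff σ := rfl

theorem mem_invariants {hM : IsConjStable K M} {x : Skew M} :
    x ∈ invariants hM ↔ ∀ g : L ≃ₐ[K] L, galAct hM g x = x := by
  simp [invariants, Algebra.mem_iInf, AlgHom.mem_equalizer]

/-- The sum of the conjugates of `σ` under the Galois group. -/
noncomputable def conjSum [FiniteDimensional K L] (hM : IsConjStable K M) (σ : M) : Skew M :=
  ∑ g : L ≃ₐ[K] L, SkewMonoidAlgebra.single (conjHom hM g σ) 1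

theorem conjSum_mem_invariants [FiniteDimensional K L] (hM : IsConjStable K M) (σ : M) :
    conjSum hM σ ∈ invariants hM := by
  rw [mem_invariants]
  intro h
  rw [conjSum, map_sum]
  refine Fintype.sum_equiv (Equiv.mulLeft h) _ _ fun g => ?_
  rw [galAct_single, map_one]
  congr 1

/-- Different `g` may give the same conjugate, so coefficients are multiplicities; they stay nonzero
in `L` only where the characteristic does not divide them. -/
theorem coeff_conjSum [FiniteDimensional K L] (hM : IsConjStable K M) (σ τ : M) [DecidableEq M] :
    (conjSum hM σ).coeff τ =
      (Finset.univ.filter fun g : L ≃ₐ[K] L => conjHom hM g σ = τ).card := by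
  rw [conjSum, ← coeffAt_apply (S := L), map_sum]
  simp [coeffAt_apply, Finsupp.single_apply]

theorem IsGaloisRing.base_le_invariants {hM : IsConjStable K M} {U : Subalgebra k (Skew M)}
    (hU : IsGaloisRing R hM U) (c : K) :
    baseHom K M c ∈ invariants hM := by
  rw [← Subalgebra.mem_toSubmodule, ← hU.left_span]
  simpa using Submodule.mul_mem_mul (show baseHom K M c ∈
    Subalgebra.toSubmodule (baseHom K M).range from ⟨c, rfl⟩) 
    (show (1 : Skew M) ∈ Subalgebra.toSubmodule U from U.one_mem)

end Coefficients

/-! ### Finiteness from the order condition, and clearing denominators. -/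

section Order

variable {k Γ K L : Type*} [Field k] [CommRing Γ] [Algebra k Γ]
  [Field K] [Algebra k K]
  [Field L] [Algebra K L] [Algebra k L] [Algebra Γ L]
  [IsScalarTower k K L] [IsScalarTower k Γ L]
  {M : Submonoid (L ≃ₐ[k] L)} {hM : IsConjStable K M} {U : Subalgebra k (Skew M)}

/-- Translates left finite generation, phrased with products inside the noncommutative ring, into
ordinary spans over `R`; used for both `K` and `Γ`. -/
theorem toSubmodule_range_mul_span {R : Type*} [CommRing R] [Algebra k R] [Algebra R L]
    [IsScalarTower k R L] (T : Set (Skew M)) :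
    Subalgebra.toSubmodule (baseHom R M).range * Submodule.span k T =
      (Submodule.span R T).restrictScalars k := by
  apply le_antisymm
  · rw [Submodule.mul_le]
    rintro _ ⟨r, rfl⟩ x hx
    change baseHom R M r * x ∈ _
    rw [baseHom_mul_eq_smul]
    exact Submodule.smul_mem _ r (Submodule.span_le_restrictScalars k R T hx)
  · intro x hx
    refine Submodule.span_induction (p := fun x _ => x ∈ _) ?_ ?_ ?_ ?_ hx
    · intro t ht
      have h := Submodule.mul_mem_mul (show (1 : Skew M) ∈ Subalgebra.toSubmodule
        (baseHom R M).range from (baseHom R M).range.one_mem) (Submodule.subset_span (R := k) ht)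
      rwa [one_mul] at h
    · exact Submodule.zero_mem _
    · intro x y _ _ hx hy
      exact Submodule.add_mem _ hx hy
    · intro r x _ hx
      rw [← baseHom_mul_eq_smul]
      have h := Submodule.mul_mem_mul (show baseHom R M r ∈ Subalgebra.toSubmodule
        (baseHom R M).range from ⟨r, rfl⟩) hx
      rwa [← mul_assoc, (Subalgebra.isIdempotentElem_toSubmodule _).eq] at h

/-- The elements of `L * M` supported in `S`, as a `K`-subspace. -/
noncomputable def supportedSubspace (K : Type*) [Field K] [Algebra K L] (S : Set M) :
    Submodule K (Skew M) :=
  ⨅ σ ∈ Sᶜ, LinearMap.ker (coeffAt K σ)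

theorem mem_supportedSubspace {F : Type*} [Field F] [Algebra F L] {S : Set M} {x : Skew M} :
    x ∈ supportedSubspace F S ↔ ∀ σ ∉ S, x.coeff σ = 0 := by
  simp [supportedSubspace, coeffAt_apply]

theorem finite_supportedSubspace {F : Type*} [Field F] [Algebra F L] [FiniteDimensional F L]
    {S : Set M} (hS : S.Finite) :
    Module.Finite F (supportedSubspace F S) := by
  have := hS.to_subtype
  refine Module.Finite.of_injective ((LinearMap.pi fun σ : S => coeffAt F σ.1).comp
    (supportedSubspace F S).subtype) ?_
  rintro ⟨x, hx⟩ ⟨y, hy⟩ h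
  rw [Subtype.mk.injEq]
  ext σ
  by_cases hσ : σ ∈ S
  · rw [← coeffAt_apply (S := F), ← coeffAt_apply (S := F)]
    exact congrFun h ⟨σ, hσ⟩
  · rw [mem_supportedSubspace.1 hx σ hσ, mem_supportedSubspace.1 hy σ hσ]

/-- The invariants supported in `S`, as a `K`-subspace. -/
noncomputable def IsGaloisRing.supportedInvariants (hU : IsGaloisRing Γ hM U) (S : Set M) :
    Submodule K (Skew M) where
  carrier := {x | x ∈ invariants hM ∧ x ∈ supportedSubspace K S}
  add_mem' hx hy := ⟨add_mem hx.1 hy.1, add_mem hx.2 hy.2⟩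
  zero_mem' := ⟨zero_mem _, zero_mem _⟩
  smul_mem' c x hx := ⟨by
    rw [← baseHom_mul_eq_smul]
    exact mul_mem (hU.base_le_invariants c) hx.1, Submodule.smul_mem _ c hx.2⟩

theorem IsGaloisRing.isFGLeft_supportedInvariants [FiniteDimensional K L]
    (hU : IsGaloisRing Γ hM U) {S : Set M} (hS : S.Finite) :
    IsFGLeft (baseHom K M).range ((hU.supportedInvariants S).restrictScalars k) := by
  have := finite_supportedSubspace (F := K) hS
  have hle : hU.supportedInvariants S ≤ supportedSubspace K S := fun x hx => hx.2
  have : (hU.supportedInvariants S).FG :=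
    Module.Finite.iff_fg.1 (Submodule.finiteDimensional_of_le hle)
  obtain ⟨T, hT⟩ := this
  exact ⟨T, by rw [toSubmodule_range_mul_span, hT]⟩

/-- The coefficients at `σ` of the elements of a Galois order supported in a finite set lie in a
finitely generated `Γ`-submodule of `L` that is stable under `σ(Γ)`. -/
theorem IsGaloisOrder.exists_fg_stable [FiniteDimensional K L] (hU : IsGaloisOrder Γ hM U)
    {u : Skew M} (hu : u ∈ U) (σ : M) :
    ∃ P : Submodule Γ L, P.FG ∧ u.coeff σ ∈ P ∧
      ∀ γ : Γ, ∀ x ∈ P, x * (σ : L ≃ₐ[k] L) (algebraMap Γ L γ) ∈ P := by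
  -- The order condition is applied to all invariants supported in the support of `u`: a finite
  -- dimensional left `K`-space that right multiplication by `Γ` preserves.
  set S : Set M := (u.support : Set M) with hS
  have hS' : S.Finite := Finset.finite_toSet _
  set W := (hU.supportedInvariants S).restrictScalars k with hW
  obtain ⟨T, hT⟩ := hU.left_order W (fun x hx => hx.1) (hU.isFGLeft_supportedInvariants hS')
  rw [toSubmodule_range_mul_span] at hT
  have hmem : ∀ x, x ∈ Submodule.span Γ (T : Set (Skew M)) ↔ x ∈ W ∧ x ∈ U := fun x => by
    rw [← Submodule.restrictScalars_mem k, ← hT]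
    rfl
  refine ⟨(Submodule.span Γ (T : Set (Skew M))).map (coeffAt Γ σ), Submodule.FG.map _ ⟨T, rfl⟩,
    ⟨u, (hmem u).2 ⟨⟨hU.le_invariants hu, ?_⟩, hu⟩, rfl⟩, ?_⟩
  · rw [mem_supportedSubspace]
    intro τ hτ
    simpa [hS] using hτ
  · rintro γ _ ⟨x, hx, rfl⟩
    obtain ⟨hxW, hxU⟩ := (hmem x).1 hx
    have hγU := U.mul_mem hxU (hU.base_le γ)
    -- Right multiplication by `γ` scales the coefficient at `σ` by `σ(γ)` and does not enlarge the
    -- support.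
    refine ⟨x * baseHom Γ M γ, (hmem _).2 ⟨⟨hU.le_invariants hγU, ?_⟩, hγU⟩,
      coeff_mul_baseHom _ _ _⟩
    rw [mem_supportedSubspace]
    intro τ hτ
    rw [coeff_mul_baseHom, mem_supportedSubspace.1 hxW.2 τ hτ, zero_mul]

/-- The `Γ`-subalgebra `Γ[σ(Γ)]` of `L`. -/
def compositum (Γ : Type*) [CommRing Γ] [Algebra Γ L] (σ : L ≃ₐ[k] L) : Subalgebra Γ L :=
  Algebra.adjoin Γ (Set.range fun γ : Γ => σ (algebraMap Γ L γ))

/-- Multiplication by the nonzero coefficient of `u` at `σ` embeds `Γ[σ(Γ)]` into a finitely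
generated `Γ`-module stable under `σ(Γ)`, and `Γ` is noetherian. -/
theorem IsGaloisOrder.isNoetherian_compositum [IsNoetherianRing Γ] [FiniteDimensional K L]
    (hU : IsGaloisOrder Γ hM U) {u : Skew M} (hu : u ∈ U) {σ : M} (hσ : u.coeff σ ≠ 0) :
    IsNoetherian Γ (compositum Γ (σ : L ≃ₐ[k] L)) := by
  obtain ⟨P, hP, huP, hstable⟩ := hU.exists_fg_stable hu σ
  have hb : ∀ b ∈ compositum Γ (σ : L ≃ₐ[k] L), ∀ x ∈ P, x * b ∈ P := by
    intro b hb
    induction hb using Algebra.adjoin_induction with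
    | mem b hb =>
      obtain ⟨γ, rfl⟩ := hb
      exact hstable γ
    | algebraMap γ =>
      intro x hx
      rw [mul_comm, ← Algebra.smul_def]
      exact P.smul_mem γ hx
    | add a b _ _ ha hb =>
      intro x hx
      rw [mul_add]
      exact P.add_mem (ha x hx) (hb x hx)
    | mul a b _ _ ha hb =>
      intro x hx
      rw [← mul_assoc]
      exact hb _ (ha x hx)
  have := isNoetherian_of_fg_of_noetherian P hP
  refine isNoetherian_of_injective (P := P) (((LinearMap.mulLeft Γ (u.coeff σ)).comp
    (compositum Γ (σ : L ≃ₐ[k] L)).val.toLinearMap).codRestrict P fun b =>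
      hb b b.2 _ huP) ?_
  intro a b h
  exact Subtype.ext (mul_left_cancel₀ hσ (congrArg Subtype.val h))

variable [Algebra Γ K] [IsScalarTower Γ K L]

/-- Since `KU` is the whole invariant ring, an invariant is a finite sum of terms `c u` with `c ∈ K`
and `u ∈ U`; a product of denominators clears them all because `Γ` is commutative. -/
theorem IsGaloisRing.exists_baseHom_mul_mem [IsDomain Γ] [IsFractionRing Γ K]
    (hU : IsGaloisRing Γ hM U) {x : Skew M} (hx : x ∈ invariants hM) :
    ∃ γ : Γ, γ ≠ 0 ∧ baseHom Γ M γ * x ∈ U := by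
  rw [← Subalgebra.mem_toSubmodule, ← hU.left_span] at hx
  induction hx using Submodule.mul_induction_on' with
  | mem_mul_mem a ha u hu =>
    obtain ⟨c, rfl⟩ := ha
    obtain ⟨a, b, hb, rfl⟩ := IsFractionRing.div_surjective (A := Γ) c
    refine ⟨b, nonZeroDivisors.ne_zero hb, ?_⟩
    have h : baseHom Γ M b * baseHom K M (algebraMap Γ K a / algebraMap Γ K b) =
        baseHom Γ M a := by
      have hb' : algebraMap Γ K b ≠ 0 :=
        (map_ne_zero_iff _ (IsFractionRing.injective Γ K)).2 (nonZeroDivisors.ne_zero hb)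
      rw [← baseHom_algebraMap (S := K) b, ← baseHom_algebraMap (S := K) a, ← map_mul,
        mul_div_cancel₀ _ hb']
    change baseHom Γ M b * (baseHom K M (algebraMap Γ K a / algebraMap Γ K b) * u) ∈ U
    rw [← mul_assoc, h]
    exact U.mul_mem (hU.base_le a) hu
  | add x _ y _ ihx ihy =>
    obtain ⟨a, ha, hax⟩ := ihx
    obtain ⟨b, hb, hby⟩ := ihy
    refine ⟨a * b, mul_ne_zero ha hb, ?_⟩
    have h : baseHom Γ M (a * b) * (x + y) =
        baseHom Γ M b * (baseHom Γ M a * x) + baseHom Γ M a * (baseHom Γ M b * y) := by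
      simp only [baseHom_mul_eq_smul, smul_smul, smul_add, mul_comm b a]
    rw [h]
    exact U.add_mem (U.mul_mem (hU.base_le b) hax) (U.mul_mem (hU.base_le a) hby)

end Order

/-! ### The set `S(m, n)` and the ideal it provides. -/

section Connecting

variable {k Γ K L : Type*} [Field k] [CommRing Γ]
  [Field K] [Algebra k K]
  [Field L] [Algebra K L] [Algebra k L] [Algebra Γ L]
  [IsScalarTower k K L]
  {M : Submonoid (L ≃ₐ[k] L)}

/-- Apply `g` to `g₂(ln) = σ g₁(lm)` and write `g σ g₁ = (g σ g⁻¹)(g g₁)`. -/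
theorem conjHom_mem_connecting {hM : IsConjStable K M} {lm ln : Ideal (integralClosure Γ L)}
    {σ : M} (hσ : σ ∈ connecting K M lm ln) (g : L ≃ₐ[K] L) :
    conjHom hM g σ ∈ connecting K M lm ln := by
  obtain ⟨g₁, g₂, h⟩ := hσ
  refine ⟨g * g₁, g * g₂, ?_⟩
  have hτ : ∀ (τ : L ≃ₐ[k] L) (l : Ideal (integralClosure Γ L)),
      translate (galAut k g * τ) l = galAut k g '' translate τ l := by
    intro τ l
    rw [translate, translate, Set.image_image]
    rfl
  have h1 : ((conjHom hM g σ : M) : L ≃ₐ[k] L) * galAut k (g * g₁) =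
      galAut k g * ((σ : L ≃ₐ[k] L) * galAut k g₁) := by
    simp [conjHom, mul_assoc]
  rw [h1, map_mul, hτ, hτ, h]

variable [Algebra Γ K] [IsScalarTower Γ K L]

theorem galAut_algebraMap (g : L ≃ₐ[K] L) (γ : Γ) :
    galAut k g (algebraMap Γ L γ) = algebraMap Γ L γ := by
  rw [IsScalarTower.algebraMap_apply Γ K L]
  exact g.commutes _

/-- For `σ` in `S(m, n)`, some proper ideal of `Γ[σ(Γ)]` contains both `n` and `σ(m)`. -/
theorem exists_ideal_compositum {lm ln : Ideal (integralClosure Γ L)} {m n : Ideal Γ}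
    (hlm : LiesAbove lm m) (hln : LiesAbove ln n) {σ : M} (hσ : σ ∈ connecting K M lm ln)
    [Algebra.IsIntegral Γ (compositum Γ (σ : L ≃ₐ[k] L))] :
    ∃ q : Ideal (compositum Γ (σ : L ≃ₐ[k] L)), q ≠ ⊤ ∧
      (∀ γ ∈ n, algebraMap Γ _ γ ∈ q) ∧
      ∀ γ ∈ m, ⟨(σ : L ≃ₐ[k] L) (algebraMap Γ L γ), Algebra.subset_adjoin ⟨γ, rfl⟩⟩ ∈ q := by
  obtain ⟨g₁, g₂, h⟩ := hσ
  -- By integrality, `g₂⁻¹` carries `Γ[σ(Γ)]` into the integral closure; the ideal sought is the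
  -- contraction of `ln` along this map.
  let φ : L →ₐ[Γ] L := ((g₂⁻¹ : L ≃ₐ[K] L) : L →ₐ[K] L).restrictScalars Γ
  let ψ : compositum Γ (σ : L ≃ₐ[k] L) →ₐ[Γ] integralClosure Γ L :=
    (φ.comp (compositum Γ (σ : L ≃ₐ[k] L)).val).codRestrict _ fun b =>
      (Algebra.IsIntegral.isIntegral (R := Γ) b).map (φ.comp (compositum Γ _).val)
  refine ⟨ln.comap ψ, Ideal.comap_ne_top _ hln.1.ne_top, fun γ hγ => ?_, fun γ hγ => ?_⟩
  · rw [Ideal.mem_comap, AlgHom.commutes, ← Ideal.mem_comap, hln.2]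
    exact hγ
  · rw [← hlm.2] at hγ
    -- As `g₁` fixes `Γ`, `σ(γ) = σ g₁(γ)` lies in `σ g₁(lm) = g₂(ln)`, so `g₂⁻¹` sends it into
    -- `ln`.
    have hmem : (σ : L ≃ₐ[k] L) (algebraMap Γ L γ) ∈
        translate ((σ : L ≃ₐ[k] L) * galAut k g₁) lm :=
      ⟨_, hγ, congrArg (σ : L ≃ₐ[k] L) (galAut_algebraMap (k := k) g₁ γ)⟩
    rw [← h] at hmem
    obtain ⟨y, hy, hy'⟩ := hmem
    have : ψ ⟨(σ : L ≃ₐ[k] L) (algebraMap Γ L γ), Algebra.subset_adjoin ⟨γ, rfl⟩⟩ = y := by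
      apply Subtype.ext
      change g₂⁻¹ ((σ : L ≃ₐ[k] L) (algebraMap Γ L γ)) = y
      rw [← hy']
      exact g₂.symm_apply_apply _
    rw [Ideal.mem_comap, this]
    exact hy

end Connecting

/-! ### Vanishing in the limit, and Krull's intersection theorem. -/

section Completion

variable {k Γ K L : Type*} [Field k] [CommRing Γ] [Algebra k Γ]
  [Field K] [Algebra k K] [Algebra Γ K]
  [Field L] [Algebra K L] [Algebra k L] [Algebra Γ L]
  [IsScalarTower k K L] [IsScalarTower Γ K L] [IsScalarTower k Γ L]
  {M : Submonoid (L ≃ₐ[k] L)} {hM : IsConjStable K M} {U : Subalgebra k (Skew M)}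

theorem directedSystem_completion {U : Type*} [Ring U] [Algebra k U] (i : Γ →ₐ[k] U)
    (m n : Ideal Γ) : DirectedSystem (fun V : FGBimodule i => completion i m n V.1)
      fun _ _ h => completionMap i m n h where
  map_self := by
    rintro V ⟨x, hx⟩
    ext p
    obtain ⟨v, hv⟩ := Submodule.mkQ_surjective _ (x p)
    change Submodule.mapQ (level i m n V.1 p) (level i m n V.1 p) (Submodule.inclusion le_rfl)
      (level_le_comap i m n le_rfl p) (x p) = x p
    rw [← hv]
    rfl
  map_map := by
    rintro V W X hVW hWX ⟨x, hx⟩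
    ext p
    obtain ⟨v, hv⟩ := Submodule.mkQ_surjective _ (x p)
    change Submodule.mapQ (level i m n W.1 p) (level i m n V.1 p) (Submodule.inclusion hWX)
        (level_le_comap i m n hWX p)
      (Submodule.mapQ (level i m n X.1 p) (level i m n W.1 p) (Submodule.inclusion hVW)
        (level_le_comap i m n hVW p) (x p)) =
      Submodule.mapQ (level i m n X.1 p) (level i m n V.1 p) (Submodule.inclusion (hVW.trans hWX))
        (level_le_comap i m n (hVW.trans hWX) p) (x p)
    rw [← hv]
    rfl

/-- In a directed limit an element vanishes already at some stage `V`, and in the completion of `V`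
this means vanishing modulo every level. -/
theorem mem_ker_toHom {U : Type*} [Ring U] [Algebra k U] {i : Γ →ₐ[k] U} {m n : Ideal Γ} {u : U}
    (h : u ∈ LinearMap.ker (toHom i m n)) : ∃ V : FGBimodule i, u ∈ V.1 ∧
      ∀ a b, u ∈ idealImage i (n ^ a) * V.1 ⊔ V.1 * idealImage i (m ^ b) := by
  classical
  have := directedSystem_completion i m n
  obtain ⟨V, hV, h0⟩ := Module.DirectLimit.of.zero_exact h
  refine ⟨V, hV (mem_principal i u), fun a b => ?_⟩
  rw [completionMap_toCompletion] at h0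
  have := congrFun (congrArg Subtype.val h0) (a, b)
  exact (Submodule.Quotient.mk_eq_zero (level i m n V.1 (a, b))).1 this

theorem map_mem_pow {R S : Type*} [CommRing R] [CommRing S] {f : R →+* S} {I : Ideal R}
    {J : Ideal S} (h : ∀ x ∈ I, f x ∈ J) (a : ℕ) {x : R} (hx : x ∈ I ^ a) : f x ∈ J ^ a :=
  Ideal.le_comap_pow f a (Ideal.pow_right_mono (show I ≤ J.comap f from h) a hx)

theorem eq_zero_of_forall_mem_pow_smul_span {B E : Type*} [CommRing B] [IsDomain B]
    [IsNoetherianRing B] [AddCommGroup E] [Module B E] [Module.IsTorsionFree B E] {q : Ideal B}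
    (hq : q ≠ ⊤) {T : Set E} (hT : T.Finite) {x : E} (hx : ∀ a : ℕ, x ∈ q ^ a • Submodule.span B T) :
    x = 0 := by
  have hfin : Module.Finite B (Submodule.span B T) := Module.Finite.span_of_finite B hT
  have hxT : x ∈ Submodule.span B T := Submodule.smul_le_right (hx 0)
  have hmem : (⟨x, hxT⟩ : Submodule.span B T) ∈
      (⨅ a : ℕ, q ^ a • ⊤ : Submodule B (Submodule.span B T)) := by
    rw [Submodule.mem_iInf]
    intro a
    have h := hx a
    rw [← Submodule.map_subtype_top (Submodule.span B T), ← Submodule.map_smul''] at h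
    obtain ⟨y, hy, rfl⟩ := h
    exact hy
  rw [Ideal.iInf_pow_smul_eq_bot_of_isTorsionFree q hq, Submodule.mem_bot] at hmem
  exact congrArg Subtype.val hmem

/-- A map `π : U → E` to a torsion-free module over a noetherian domain `B`, through which the left
and right actions of `Γ` become multiplication by elements of `B`, kills the elements of `U` that
vanish in `Hom m n`, provided that `n` and `m` act through a proper ideal of `B`. -/
theorem map_eq_zero_of_mem_ker_toHom {U B E : Type*} [Ring U] [Algebra k U] {i : Γ →ₐ[k] U}
    [CommRing B] [IsDomain B] [IsNoetherianRing B] [Algebra k B] [AddCommGroup E] [Module k E]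
    [Module B E] [IsScalarTower k B E] [Module.IsTorsionFree B E] (π : U →ₗ[k] E) (l r : Γ →+* B)
    (hl : ∀ γ x, π (i γ * x) = l γ • π x) (hr : ∀ γ x, π (x * i γ) = r γ • π x)
    {m n : Ideal Γ} {q : Ideal B} (hq : q ≠ ⊤) (hn : ∀ γ ∈ n, l γ ∈ q) (hm : ∀ γ ∈ m, r γ ∈ q)
    {u : U} (hu : u ∈ LinearMap.ker (toHom i m n)) : π u = 0 := by
  obtain ⟨⟨V, T, hT⟩, -, hlevel⟩ := mem_ker_toHom hu
  -- Both actions of `Γ` become scalars from `B`, so the images of bimodule generators generate over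
  -- `B`.
  have hVN : V ≤ ((Submodule.span B (π '' T)).restrictScalars k).comap π := by
    rw [hT, bimoduleSpan, Submodule.mul_le]
    rintro x hx _ ⟨γ, rfl⟩
    change π (x * i γ) ∈ Submodule.span B (π '' T)
    rw [hr]
    refine Submodule.smul_mem _ _ ?_
    revert x
    change _ ≤ ((Submodule.span B (π '' T)).restrictScalars k).comap π
    rw [Submodule.mul_le]
    rintro _ ⟨γ', rfl⟩ x hx
    change π (i γ' * x) ∈ Submodule.span B (π '' T)
    rw [hl]
    refine Submodule.smul_mem _ _ ?_
    revert x
    change _ ≤ ((Submodule.span B (π '' T)).restrictScalars k).comap π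
    rw [Submodule.span_le]
    intro t ht
    exact Submodule.subset_span ⟨t, ht, rfl⟩
  refine eq_zero_of_forall_mem_pow_smul_span hq (T.finite_toSet.image π) fun a => ?_
  -- The diagonal levels `(a, a)` suffice: both summands then map into the same `q ^ a N`.
  have hle : idealImage i (n ^ a) * V ⊔ V * idealImage i (m ^ a) ≤
      ((q ^ a • Submodule.span B (π '' T)).restrictScalars k).comap π := by
    refine sup_le (Submodule.mul_le.2 ?_) (Submodule.mul_le.2 ?_)
    · rintro _ ⟨γ, hγ, rfl⟩ v hv
      change π (i γ * v) ∈ q ^ a • Submodule.span B (π '' T)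
      rw [hl]
      exact Submodule.smul_mem_smul (map_mem_pow hn a hγ) (hVN hv)
    · rintro v hv _ ⟨γ, hγ, rfl⟩
      change π (v * i γ) ∈ q ^ a • Submodule.span B (π '' T)
      rw [hr]
      exact Submodule.smul_mem_smul (map_mem_pow hm a hγ) (hVN hv)
  exact hle (hlevel a a)

/-- The preceding criterion with `B = Γ[σ(Γ)]`, `E = L` and `π` the coefficient at `σ`: the left
action is the inclusion of `Γ`, the right one is `σ` restricted to `Γ`. -/
theorem IsGaloisOrder.notMem_ker_toHom [IsNoetherianRing Γ] [FiniteDimensional K L]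
    (hU : IsGaloisOrder Γ hM U) {m n : Ideal Γ} {lm ln : Ideal (integralClosure Γ L)}
    (hlm : LiesAbove lm m) (hln : LiesAbove ln n) {σ : M} (hσ : σ ∈ connecting K M lm ln)
    {u : U} (hu : (u : Skew M).coeff σ ≠ 0) :
    u ∉ LinearMap.ker (toHom hU.toIsGaloisRing.incl m n) := by
  intro h
  have hB := hU.isNoetherian_compositum u.2 hu
  have : IsNoetherianRing (compositum Γ (σ : L ≃ₐ[k] L)) := isNoetherian_of_tower Γ hB
  obtain ⟨q, hq, hnq, hmq⟩ := exists_ideal_compositum hlm hln hσ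
  let s : Γ →+* compositum Γ (σ : L ≃ₐ[k] L) :=
    (((σ : L ≃ₐ[k] L) : L →+* L).comp (algebraMap Γ L)).codRestrict (compositum Γ (σ : L ≃ₐ[k] L))
      fun γ => Algebra.subset_adjoin ⟨γ, rfl⟩
  refine hu (map_eq_zero_of_mem_ker_toHom ((coeffAt k σ).comp U.val.toLinearMap)
    (algebraMap Γ (compositum Γ (σ : L ≃ₐ[k] L))) s ?_ ?_ hq hnq hmq h)
  · exact fun γ x => coeff_baseHom_mul γ (x : Skew M) σ
  · exact fun γ x => (coeff_mul_baseHom γ (x : Skew M) σ).trans (mul_comm _ _)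

end Completion

end GaloisOrder

/-! ### Conclusion. -/

theorem mainTheorem10
    {k Γ K L : Type*} [Field k] [IsAlgClosed k] [CharZero k]
    [CommRing Γ] [IsDomain Γ] [IsNoetherianRing Γ] [Algebra k Γ]
    [Field K] [Algebra k K] [Algebra Γ K] [IsScalarTower k Γ K] [IsFractionRing Γ K]
    [Field L] [Algebra K L] [Algebra k L] [Algebra Γ L]
    [IsScalarTower k K L] [IsScalarTower Γ K L] [IsScalarTower k Γ L]
    [FiniteDimensional K L] [IsGalois K L]
    (M : Submonoid (L ≃ₐ[k] L)) (hM : GaloisOrder.IsConjStable K M)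
    (hsep : GaloisOrder.IsSeparating K M)
    (U : Subalgebra k (GaloisOrder.Skew M)) (hU : GaloisOrder.IsGaloisOrder Γ hM U)
    (m n : Ideal Γ) (hm : m.IsMaximal) (hn : n.IsMaximal)
    (lm ln : Ideal (integralClosure Γ L))
    (hlm : GaloisOrder.LiesAbove lm m) (hln : GaloisOrder.LiesAbove ln n)
    (hfin : (GaloisOrder.connecting K M lm ln).Finite)
    (hfin_m : (GaloisOrder.stabilizer M lm).Finite)
    (hfin_n : (GaloisOrder.stabilizer M ln).Finite)
    (hne : (GaloisOrder.connecting K M lm ln).Nonempty) :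
    (GaloisOrder.supportedIn U (GaloisOrder.connecting K M lm ln)).map
      (GaloisOrder.toHom hU.toIsGaloisRing.incl m n) ≠ ⊥ := by
  classical
  have : CharZero L := charZero_of_injective_algebraMap (algebraMap k L).injective
  obtain ⟨σ, hσ⟩ := hne
  have hexists := hU.exists_baseHom_mul_mem (GaloisOrder.conjSum_mem_invariants hM σ)
  rcases hexists with ⟨γ, hγ'⟩
  have hγ := hγ'.1
  have hγU : GaloisOrder.baseHom Γ M γ * GaloisOrder.conjSum hM σ ∈ U := hγ'.2
  have hcoeff : (GaloisOrder.baseHom Γ M γ * GaloisOrder.conjSum hM σ).coeff σ ≠ 0 := by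
    have hinj : Function.Injective (algebraMap Γ L) := by
      rw [IsScalarTower.algebraMap_eq Γ K L]
      exact (algebraMap K L).injective.comp (IsFractionRing.injective Γ K)
    rw [GaloisOrder.coeff_baseHom_mul, GaloisOrder.coeff_conjSum]
    refine mul_ne_zero ((map_ne_zero_iff _ hinj).2 hγ) (Nat.cast_ne_zero.2 ?_)
    -- Conjugation by `1` fixes `σ`, so the multiplicity is positive, hence nonzero in
    -- characteristic `0`.
    exact Finset.card_ne_zero_of_mem (a := 1) (by simp [GaloisOrder.conjHom, Subtype.ext_iff])
  have hsupp : (⟨_, hγU⟩ : U) ∈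
      GaloisOrder.supportedIn U (GaloisOrder.connecting K M lm ln) := by
    intro τ hτ
    change (GaloisOrder.baseHom Γ M γ * GaloisOrder.conjSum hM σ).coeff τ ≠ 0 at hτ
    rw [GaloisOrder.coeff_baseHom_mul, GaloisOrder.coeff_conjSum] at hτ
    obtain ⟨g, hg⟩ := Finset.card_ne_zero.1 (Nat.cast_ne_zero.1 (right_ne_zero_of_mul hτ))
    rw [← (Finset.mem_filter.1 hg).2]
    exact GaloisOrder.conjHom_mem_connecting hσ g
  intro hbot
  exact hU.notMem_ker_toHom hlm hln hσ (u := ⟨_, hγU⟩) hcoeff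
    ((LinearMap.le_ker_iff_map).2 hbot hsupp)
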